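/- Let $N\ge 1$, $d\ge 0$, let $v_1,\dots,v_N\in\mathbb R^d$, and for $i\ne j$ in $\mathcal S=\{1,\dots,N\}$ let $a_{ij}:\mathbb R^d\to[0,\infty)$ be a Borel function that is bounded on bounded sets (for example, a continuous one). Let $(X,L)$ be the time-homogeneous Markov process on $\mathcal S\times\mathbb R^d$ in which $X$ is right-continuous with left limits, $$L(t)=L(0)+\sum_{j\in\mathcal S} v_j L_j(t),\qquad L_j(t)=\mathrm{Leb}\{s\in[0,t]:X(s)=j\},$$ and $X$ jumps from $i$ to $j$ at rate $a_{ij}(L(t))$; that is, $(X,L)$ has the generator $$Af(j,l)=v_j\cdot\nabla_l f(j,l)+\sum_{i\ne j}a_{ji}(l)\,[f(i,l)-f(j,l)],$$ in the sense that, for every starting point and every $f$ such that all $f(j,\cdot)$ are $C^1$ with compact support, $f(X(t),L(t))-\int_0^t Af(X(s),L(s))\,ds$ is a martingale for the filtration generated by $(X,L)$. Let $p_1,\dots,p_N\ge 0$ with $\sum_{j} p_j=1$ and let $g\ge 0$ be an integrable function on $\mathbb R^d$ with $\int_{\mathbb R^d} g(l)\,dl=1$. If the probability measure $p_j\,g(l)\,dj\,dl$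 on $\mathcal S\times\mathbb R^d$ (where $dj$ is counting measure and $dl$ is Lebesgue measure) is invariant for the process $(X,L)$, then $$\sum_{j\in\mathcal S}p_j v_j=0 .$$ -/

import Mathlib

open MeasureTheory ProbabilityTheory Filter Topology
open scoped NNReal

namespace InertDrift

/-- The state space `{1, …, N} × ℝ^d`. -/
abbrev State (N d : ℕ) : Type := Fin N × EuclideanSpace ℝ (Fin d)

/-- The generator
`A f (j, l) = v_j · ∇_l f (j, l) + ∑_{i ≠ j} a_{ji}(l) (f (i, l) - f (j, l))`. -/
noncomputable def generator {N d : ℕ} (v : Fin N → EuclideanSpace ℝ (Fin d))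
    (a : Fin N → Fin N → EuclideanSpace ℝ (Fin d) → ℝ)
    (f : Fin N → EuclideanSpace ℝ (Fin d) → ℝ) (z : State N d) : ℝ :=
  inner ℝ (v z.1) (gradient (f z.1) z.2)
    + ∑ i ∈ Finset.univ.filter (fun i => i ≠ z.1), a z.1 i z.2 * (f i z.2 - f z.1 z.2)

/-- The occupation time `L_j(t)`: the Lebesgue measure of `{s ∈ [0, t] : x s = j}`. -/
noncomputable def occupationTime {N : ℕ} (x : ℝ≥0 → Fin N) (j : Fin N) (t : ℝ≥0) : ℝ :=
  (volume {s : ℝ | s ∈ Set.Icc 0 (t : ℝ) ∧ x s.toNNReal = j}).toReal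

/-- A family of laws `law z`, one for every starting point `z`, on a sample space carrying a
right-continuous process `X` with left limits and the process
`L(t) = L(0) + ∑_j v_j L_j(t)`. -/
structure PathFamily {N d : ℕ} (v : Fin N → EuclideanSpace ℝ (Fin d))
    (Ω : Type*) [MeasurableSpace Ω] where
  /-- The law of the process started at a given point. -/
  law : Kernel (State N d) Ω
  markovKernel : IsMarkovKernel law
  X : ℝ≥0 → Ω → Fin N
  L : ℝ≥0 → Ω → EuclideanSpace ℝ (Fin d)
  measurable_X : ∀ t, Measurable (X t)
  measurable_L : ∀ t, Measurable (L t)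
  rightCts_X : ∀ ω t, ContinuousWithinAt (fun s => X s ω) (Set.Ici t) t
  leftLim_X : ∀ ω t, 0 < t → ∃ j, Tendsto (fun s => X s ω) (𝓝[<] t) (𝓝 j)
  L_eq : ∀ ω t, L t ω = L 0 ω + ∑ j, occupationTime (fun s => X s ω) j t • v j
  start : ∀ z, ∀ᵐ ω ∂(law z), (X 0 ω, L 0 ω) = z

namespace PathFamily

variable {N d : ℕ} {v : Fin N → EuclideanSpace ℝ (Fin d)} {Ω : Type*} [mΩ : MeasurableSpace Ω]

/-- The pair `(X(t), L(t))`. -/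
def Z (P : PathFamily v Ω) (t : ℝ≥0) (ω : Ω) : State N d := (P.X t ω, P.L t ω)

theorem measurable_Z (P : PathFamily v Ω) (t : ℝ≥0) : Measurable (P.Z t) :=
  (P.measurable_X t).prodMk (P.measurable_L t)

/-- The filtration generated by `(X, L)`. -/
def history (P : PathFamily v Ω) : Filtration ℝ≥0 mΩ where
  seq t := ⨆ s ≤ t, MeasurableSpace.comap (P.Z s) inferInstance
  mono' _ _ hst := biSup_mono fun _ hr => hr.trans hst
  le' _ := iSup₂_le fun s _ => (P.measurable_Z s).comap_le

/-- The transition kernels `P_t(z, B) = law z ((X(t), L(t)) ∈ B)`. -/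
noncomputable def transition (P : PathFamily v Ω) (t : ℝ≥0) : Kernel (State N d) (State N d) :=
  P.law.map (P.Z t)

/-- The (time-homogeneous) Markov property. -/
def IsMarkov (P : PathFamily v Ω) : Prop :=
  ∀ (z : State N d) (s t : ℝ≥0) (B : Set (State N d)), MeasurableSet B →
    (P.law z)[(P.Z (s + t) ⁻¹' B).indicator (fun _ => (1 : ℝ)) | P.history s]
      =ᵐ[P.law z] fun ω => (P.transition t (P.Z s ω)).real B

/-- `(X, L)` has generator `A`: under each `law z`, for every compactly supported `C¹` function
`f`, the process `f(X(t), L(t)) - ∫₀ᵗ A f (X(s), L(s)) ds` is a martingale. -/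
def HasGenerator (P : PathFamily v Ω) (a : Fin N → Fin N → EuclideanSpace ℝ (Fin d) → ℝ) : Prop :=
  ∀ f : Fin N → EuclideanSpace ℝ (Fin d) → ℝ,
    (∀ j, ContDiff ℝ 1 (f j)) → (∀ j, HasCompactSupport (f j)) →
    ∀ z, Martingale
      (fun (t : ℝ≥0) ω => f (P.X t ω) (P.L t ω)
        - ∫ s in (0 : ℝ)..t, generator v a f (P.Z s.toNNReal ω))
      P.history (P.law z)

end PathFamily

/-- A realization of the Markov process `(X, L)` with velocities `v_j` and jump rates
`a_{ij}(l)`. -/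
structure InertDriftProcess {N d : ℕ} (v : Fin N → EuclideanSpace ℝ (Fin d))
    (a : Fin N → Fin N → EuclideanSpace ℝ (Fin d) → ℝ)
    (Ω : Type*) [MeasurableSpace Ω] extends PathFamily v Ω where
  isMarkov : toPathFamily.IsMarkov
  hasGenerator : toPathFamily.HasGenerator a

/-- `π` is invariant for `(X, L)`: `π P_t = π` for every `t ≥ 0`. -/
def InertDriftProcess.IsInvariant {N d : ℕ} {v : Fin N → EuclideanSpace ℝ (Fin d)}
    {a : Fin N → Fin N → EuclideanSpace ℝ (Fin d) → ℝ} {Ω : Type*} [MeasurableSpace Ω]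
    (P : InertDriftProcess v a Ω) (π : Measure (State N d)) : Prop :=
  ∀ t : ℝ≥0, Kernel.Invariant (P.toPathFamily.transition t) π

/-- The measure `p_j g(l) dj dl`, where `dj` is the counting measure and `dl` the Lebesgue
measure. -/
noncomputable def productMeasure {N d : ℕ} (p : Fin N → ℝ) (g : EuclideanSpace ℝ (Fin d) → ℝ) :
    Measure (State N d) :=
  ((Measure.count : Measure (Fin N)).prod (volume : Measure (EuclideanSpace ℝ (Fin d)))).withDensity
    (fun z => ENNReal.ofReal (p z.1 * g z.2))

end InertDrift

namespace InertDrift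

/-! Test invariance on `arctan ⟪w, L⟫`. In the stationary regime its mean is constant in time, while
each path of `L` leaves `L(0)` with right derivative `v_{X(0)}`. Dominated convergence then gives `∫
⟪w, v_j⟫ / (1 + ⟪w, l⟫²) dπ = 0` (`integral_drift_eq_zero`). For `π = p ⊗ g` this integral splits
into `⟪w, ∑ p_j v_j⟫` times a positive number; the choice `w = ∑ p_j v_j` yields `‖w‖² = 0`. The
arctangent is bounded, so `g` needs no moments, and its derivative is positive, so the second factor
cannot vanish. -/

theorem occupationTime_nonneg {N : ℕ} (x : ℝ≥0 → Fin N) (j : Fin N) (t : ℝ≥0) :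
    0 ≤ occupationTime x j t := ENNReal.toReal_nonneg

theorem occupationTime_le {N : ℕ} (x : ℝ≥0 → Fin N) (j : Fin N) (t : ℝ≥0) :
    occupationTime x j t ≤ t := by
  have h : volume {s : ℝ | s ∈ Set.Icc 0 (t : ℝ) ∧ x s.toNNReal = j} ≤ ENNReal.ofReal t := by
    refine (measure_mono (t := Set.Icc 0 (t : ℝ)) fun s hs => hs.1).trans ?_
    simp
  exact ENNReal.toReal_le_of_le_ofReal t.2 h

theorem occupationTime_of_const {N : ℕ} (x : ℝ≥0 → Fin N) (i j : Fin N) (t : ℝ≥0)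
    (h : ∀ s ≤ t, x s = i) : occupationTime x j t = if i = j then (t : ℝ) else 0 := by
  have hx : ∀ s ∈ Set.Icc 0 (t : ℝ), x s.toNNReal = i := fun s hs =>
    h _ (Real.toNNReal_le_iff_le_coe.2 hs.2)
  unfold occupationTime
  split_ifs with hij
  · have : {s : ℝ | s ∈ Set.Icc 0 (t : ℝ) ∧ x s.toNNReal = j} = Set.Icc 0 (t : ℝ) := by
      ext s
      exact ⟨fun hs => hs.1, fun hs => ⟨hs, (hx s hs).trans hij⟩⟩
    rw [this]
    simp
  · have : {s : ℝ | s ∈ Set.Icc 0 (t : ℝ) ∧ x s.toNNReal = j} = ∅ := by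
      ext s
      exact ⟨fun hs => hij ((hx s hs.1).symm.trans hs.2), fun hs => hs.elim⟩
    rw [this]
    simp

namespace PathFamily

variable {N d : ℕ} {v : Fin N → EuclideanSpace ℝ (Fin d)} {Ω : Type*} [MeasurableSpace Ω]

theorem norm_L_sub_le (P : PathFamily v Ω) (t : ℝ≥0) (ω : Ω) :
    ‖P.L t ω - P.L 0 ω‖ ≤ t * ∑ j, ‖v j‖ := by
  rw [P.L_eq ω t, add_sub_cancel_left, Finset.mul_sum]
  refine norm_sum_le_of_le _ fun j _ => ?_
  rw [norm_smul, Real.norm_of_nonneg (occupationTime_nonneg _ _ _)]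
  gcongr
  exact occupationTime_le _ _ _

/-- The state space of `X` is discrete, so right-continuity keeps `X` at `X(0)` for a positive,
path-dependent time, during which only one occupation time grows. -/
theorem eventually_L_eq (P : PathFamily v Ω) (ω : Ω) :
    ∀ᶠ t : ℝ≥0 in 𝓝 0, P.L t ω = P.L 0 ω + (t : ℝ) • v (P.X 0 ω) := by
  have h : ∀ᶠ s : ℝ≥0 in 𝓝 0, P.X s ω = P.X 0 ω := by
    have h0 := P.rightCts_X ω 0
    have hu : Set.Ici (0 : ℝ≥0) = Set.univ := Set.eq_univ_of_forall fun s => zero_le (a := s)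
    rw [hu, continuousWithinAt_univ, ContinuousAt, nhds_discrete (Fin N), tendsto_pure] at h0
    exact h0
  obtain ⟨ε, hε, hX⟩ := Metric.eventually_nhds_iff.1 h
  filter_upwards [Metric.ball_mem_nhds (0 : ℝ≥0) hε] with t ht
  rw [P.L_eq ω t]
  congr 1
  have ht' : (t : ℝ) < ε := by simpa [NNReal.dist_eq] using ht
  have hc : ∀ s ≤ t, P.X s ω = P.X 0 ω := fun s hs => hX (by
    have : (s : ℝ) ≤ t := hs
    simpa [NNReal.dist_eq] using this.trans_lt ht')
  simp [occupationTime_of_const _ _ _ t hc, ite_smul]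

/-- The right derivative at time `0` of a smooth functional of `L`. -/
theorem tendsto_arctan_inner_L (P : PathFamily v Ω) (w : EuclideanSpace ℝ (Fin d)) (ω : Ω) :
    Tendsto (fun t : ℝ≥0 => (t : ℝ)⁻¹ *
        (Real.arctan (inner ℝ w (P.L t ω)) - Real.arctan (inner ℝ w (P.L 0 ω)))) (𝓝[>] 0)
      (𝓝 (inner ℝ w (v (P.X 0 ω)) / (1 + inner ℝ w (P.L 0 ω) ^ 2))) := by
  set b := inner ℝ w (P.L 0 ω)
  set c := inner ℝ w (v (P.X 0 ω))
  have hd : HasDerivAt (fun s : ℝ => Real.arctan (b + s * c)) (c / (1 + b ^ 2)) 0 := by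
    have h1 : HasDerivAt (fun s : ℝ => b + s * c) c 0 := by
      simpa using ((hasDerivAt_id (0 : ℝ)).mul_const c).const_add b
    convert h1.arctan using 1
    simp
    ring
  have hcoe : Tendsto (fun t : ℝ≥0 => (t : ℝ)) (𝓝[>] 0) (𝓝[≠] 0) := by
    refine tendsto_nhdsWithin_iff.2 ⟨?_, ?_⟩
    · exact (NNReal.continuous_coe.tendsto' 0 0 rfl).mono_left nhdsWithin_le_nhds
    · filter_upwards [self_mem_nhdsWithin] with t ht
      exact NNReal.coe_ne_zero.2 (ne_of_gt ht)
  refine ((hasDerivAt_iff_tendsto_slope.1 hd).comp hcoe).congr' ?_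
  filter_upwards [nhdsWithin_le_nhds (P.eventually_L_eq ω)] with t ht
  simp [slope, ht, inner_add_right, inner_smul_right, b, c]

/-- Supplies the dominating constant: `arctan` is 1-Lipschitz and `L` has bounded speed. -/
theorem abs_arctan_inner_L_le (P : PathFamily v Ω) (w : EuclideanSpace ℝ (Fin d)) {t : ℝ≥0}
    (ht : 0 < t) (ω : Ω) :
    ‖(t : ℝ)⁻¹ * (Real.arctan (inner ℝ w (P.L t ω)) - Real.arctan (inner ℝ w (P.L 0 ω)))‖
      ≤ ‖w‖ * ∑ j, ‖v j‖ := by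
  have hlip : ∀ x y : ℝ, ‖Real.arctan x - Real.arctan y‖ ≤ ‖x - y‖ := fun x y => by
    have := Convex.norm_image_sub_le_of_norm_hasDerivWithin_le (f := Real.arctan)
      (f' := fun x => 1 / (1 + x ^ 2)) (s := Set.univ) (C := 1) (x := y) (y := x)
      (fun z _ => (Real.hasDerivAt_arctan z).hasDerivWithinAt)
      (fun z _ => by
        have : 0 < 1 + z ^ 2 := by positivity
        rw [Real.norm_of_nonneg (by positivity), div_le_one this]
        nlinarith [sq_nonneg z])
      convex_univ (Set.mem_univ _) (Set.mem_univ _)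
    simpa using this
  have ht' : (0 : ℝ) < t := ht
  rw [norm_mul, norm_inv, Real.norm_of_nonneg ht'.le, inv_mul_le_iff₀ ht']
  calc ‖Real.arctan (inner ℝ w (P.L t ω)) - Real.arctan (inner ℝ w (P.L 0 ω))‖
      ≤ ‖inner ℝ w (P.L t ω - P.L 0 ω)‖ := by
        rw [inner_sub_right]
        exact hlip _ _
    _ ≤ ‖w‖ * ‖P.L t ω - P.L 0 ω‖ := norm_inner_le_norm _ _
    _ ≤ ‖w‖ * (t * ∑ j, ‖v j‖) := by
        gcongr
        exact P.norm_L_sub_le t ω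
    _ = t * (‖w‖ * ∑ j, ‖v j‖) := by ring

/-- Mixing the laws `law z` over `π` gives one measure on paths whose marginal at every time is `π`.
-/
theorem exists_map_eq (P : PathFamily v Ω) (π : Measure (State N d)) [IsFiniteMeasure π]
    (hπ : ∀ t, Kernel.Invariant (P.transition t) π) :
    ∃ μ : Measure Ω, IsFiniteMeasure μ ∧ ∀ t, μ.map (P.Z t) = π := by
  have := P.markovKernel
  have hfin : IsFiniteMeasure (π.bind P.law) := inferInstance
  have hmap : ∀ t, (π.bind P.law).map (P.Z t) = π.bind (P.transition t) := fun t =>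
    Measure.map_comp π P.law (P.measurable_Z t)
  exact ⟨_, hfin, fun t => (hmap t).trans (hπ t).def⟩

/-- A finite invariant measure annihilates the drift of `arctan ⟪w, L⟫`. -/
theorem integral_drift_eq_zero (P : PathFamily v Ω) (π : Measure (State N d)) [IsFiniteMeasure π]
    (hπ : ∀ t, Kernel.Invariant (P.transition t) π) (w : EuclideanSpace ℝ (Fin d)) :
    ∫ z, inner ℝ w (v z.1) / (1 + inner ℝ w z.2 ^ 2) ∂π = 0 := by
  obtain ⟨μ, hμ, hmap⟩ := P.exists_map_eq π hπ
  have hφm : Measurable fun z : State N d => Real.arctan (inner ℝ w z.2) := by fun_prop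
  have hbd : ∀ x : ℝ, ‖Real.arctan x‖ ≤ Real.pi / 2 := fun x => by
    rw [Real.norm_eq_abs, abs_le]
    exact ⟨(Real.neg_pi_div_two_lt_arctan x).le, (Real.arctan_lt_pi_div_two x).le⟩
  have hm : ∀ t, Measurable fun ω => Real.arctan (inner ℝ w (P.L t ω)) := fun t =>
    Real.measurable_arctan.comp ((P.measurable_L t).const_inner)
  have hi : ∀ t, Integrable (fun ω => Real.arctan (inner ℝ w (P.L t ω))) μ := fun t =>
    .of_bound (hm t).aestronglyMeasurable (Real.pi / 2) (ae_of_all _ fun ω => hbd _)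
  have hφ : ∀ t, ∫ ω, Real.arctan (inner ℝ w (P.L t ω)) ∂μ
      = ∫ z, Real.arctan (inner ℝ w z.2) ∂π := fun t => by
    have := integral_map (P.measurable_Z t).aemeasurable
      (hφm.aestronglyMeasurable (μ := μ.map (P.Z t)))
    rw [hmap t] at this
    exact this.symm
  have hlim := tendsto_integral_filter_of_dominated_convergence (μ := μ) (l := 𝓝[>] (0 : ℝ≥0))
    (F := fun t ω => (t : ℝ)⁻¹ *
      (Real.arctan (inner ℝ w (P.L t ω)) - Real.arctan (inner ℝ w (P.L 0 ω))))
    (fun _ => ‖w‖ * ∑ j, ‖v j‖)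
    (Eventually.of_forall fun t => (((hm t).sub (hm 0)).const_mul _).aestronglyMeasurable)
    (by
      filter_upwards [self_mem_nhdsWithin] with t ht
      exact ae_of_all _ fun ω => P.abs_arctan_inner_L_le w ht ω)
    (integrable_const _) (ae_of_all _ fun ω => P.tendsto_arctan_inner_L w ω)
  -- By stationarity the two means agree, so every difference quotient has mean zero.
  have hzero : ∀ t : ℝ≥0, ∫ ω, (t : ℝ)⁻¹ *
      (Real.arctan (inner ℝ w (P.L t ω)) - Real.arctan (inner ℝ w (P.L 0 ω))) ∂μ = 0 := fun t => by
    rw [integral_const_mul, integral_sub (hi t) (hi 0), hφ, hφ, sub_self, mul_zero]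
  simp only [hzero] at hlim
  have h0 := tendsto_nhds_unique hlim tendsto_const_nhds
  have hψ : Measurable fun z : State N d => inner ℝ w (v z.1) / (1 + inner ℝ w z.2 ^ 2) := by
    have : Measurable fun z : State N d => v z.1 := (measurable_of_finite v).comp measurable_fst
    fun_prop
  have hψ0 := integral_map (P.measurable_Z 0).aemeasurable
    (hψ.aestronglyMeasurable (μ := μ.map (P.Z 0)))
  rw [hmap 0] at hψ0
  exact hψ0.trans h0

end PathFamily

section ProductMeasure

variable {N d : ℕ} {p : Fin N → ℝ} {g : EuclideanSpace ℝ (Fin d) → ℝ}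

theorem integrable_mul_prod_count (p : Fin N → ℝ) (hg_int : Integrable g) :
    Integrable (fun z : State N d => p z.1 * g z.2)
      ((Measure.count : Measure (Fin N)).prod volume) :=
  (Integrable.of_finite (f := p)).mul_prod hg_int

theorem isFiniteMeasure_productMeasure (hg_int : Integrable g) :
    IsFiniteMeasure (productMeasure p g) :=
  isFiniteMeasure_withDensity_ofReal (integrable_mul_prod_count p hg_int).2

/-- Fubini: under the product form, the discrete and spatial variables separate. -/
theorem integral_productMeasure (hp_nonneg : ∀ j, 0 ≤ p j) (hg_nonneg : ∀ l, 0 ≤ g l)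
    (hg_int : Integrable g) (c : Fin N → ℝ) (h : EuclideanSpace ℝ (Fin d) → ℝ) :
    ∫ z, c z.1 * h z.2 ∂(productMeasure p g) = (∑ j, p j * c j) * ∫ l, g l * h l := by
  unfold productMeasure
  rw [integral_withDensity_eq_integral_toReal_smul₀
    (integrable_mul_prod_count p hg_int).1.aemeasurable.ennreal_ofReal
    (ae_of_all _ fun _ => ENNReal.ofReal_lt_top)]
  calc _ = ∫ z : State N d, (p z.1 * c z.1) * (g z.2 * h z.2)
        ∂((Measure.count : Measure (Fin N)).prod volume) := by
        congr 1 with z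
        rw [ENNReal.toReal_ofReal (mul_nonneg (hp_nonneg _) (hg_nonneg _)), smul_eq_mul]
        ring
    _ = _ := by
        rw [integral_prod_mul (fun j => p j * c j) (fun l => g l * h l), integral_count]

end ProductMeasure

end InertDrift

theorem mainTheorem2 {N d : ℕ} (v : Fin N → EuclideanSpace ℝ (Fin d))
    (a : Fin N → Fin N → EuclideanSpace ℝ (Fin d) → ℝ)
    (ha_nonneg : ∀ i j, i ≠ j → ∀ l, 0 ≤ a i j l)
    (ha_meas : ∀ i j, i ≠ j → Measurable (a i j))
    (ha_bdd : ∀ i j, i ≠ j → ∀ r : ℝ, BddAbove (a i j '' Metric.closedBall 0 r))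
    {Ω : Type*} [MeasurableSpace Ω] (P : InertDrift.InertDriftProcess v a Ω)
    (p : Fin N → ℝ) (g : EuclideanSpace ℝ (Fin d) → ℝ)
    (hp_nonneg : ∀ j, 0 ≤ p j) (hp_sum : ∑ j, p j = 1)
    (hg_nonneg : ∀ l, 0 ≤ g l) (hg_int : Integrable g) (hg_one : ∫ l, g l = 1)
    (hinv : P.IsInvariant (InertDrift.productMeasure p g)) :
    ∑ j, p j • v j = 0 := by
  have := InertDrift.isFiniteMeasure_productMeasure (p := p) hg_int
  -- Testing in the direction of the mean drift itself turns the discrete factor into `‖w‖²`.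
  set w := ∑ j, p j • v j with hw
  have h := P.toPathFamily.integral_drift_eq_zero _ hinv w
  simp only [div_eq_mul_inv] at h
  rw [InertDrift.integral_productMeasure hp_nonneg hg_nonneg hg_int (fun j => inner ℝ w (v j))
    (fun l => (1 + inner ℝ w l ^ 2)⁻¹)] at h
  have hsum : ∑ j, p j * inner ℝ w (v j) = inner ℝ w w := by
    conv_rhs => rw [hw, inner_sum]
    simp only [inner_smul_right, ← hw]
  rw [hsum] at h
  rcases mul_eq_zero.1 h with h | h
  · exact inner_self_eq_zero.1 h
  have hpos : ∀ l, 0 < (1 + inner ℝ w l ^ 2)⁻¹ := fun l => by positivity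
  have hint : Integrable fun l => g l * (1 + inner ℝ w l ^ 2)⁻¹ := by
    refine hg_int.mul_bdd (c := 1) ?_ (ae_of_all _ fun l => ?_)
    · exact Measurable.aestronglyMeasurable (by fun_prop)
    · rw [Real.norm_of_nonneg (hpos l).le]
      exact inv_le_one_of_one_le₀ (by nlinarith [sq_nonneg (inner ℝ w l)])
  rw [integral_eq_zero_iff_of_nonneg (fun l => mul_nonneg (hg_nonneg l) (hpos l).le) hint] at h
  -- The weight is strictly positive, so a zero integral would force `g = 0` a.e., against total
  -- mass 1.
  have hg0 : g =ᵐ[volume] 0 := by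
    filter_upwards [h] with l hl
    exact (mul_eq_zero.1 hl).resolve_right (hpos l).ne'
  rw [integral_congr_ae hg0] at hg_one
  simp at hg_one
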